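/- **Theorem (Gödel / Deligne).** Let $L$ be a many-sorted first-order language with sorts, relation symbols $R\subseteq X_1\times\cdots\times X_n$, function symbols $f:X_1\times\cdots\times X_n\to Y$ and constants. The geometric formulas of $L$ are those built from the atomic formulas $R(t_1,\dots,t_n)$, $t=t'$ (with $t,t'$ of the same sort), $\top$, $\bot$ by means of $\wedge$, $\vee$ and $\exists$. A (geometric) sequent $\Gamma\vdash\Delta^V$ consists of a finite set $V$ of sorted variables and finite sets $\Gamma,\Delta$ of geometric formulas with free variables in $V$. A geometric theory is a set of geometric sequents, its axioms. A sequent is *provable* in a geometric theory $T$ if it can be derived from the axioms of $T$ by the geometric fragment of Gentzen's sequent calculus, with explicit finite sets of variables: the structural rules (identity, weakening, cut, and passage from $\Gamma\vdash\Delta^V$ to $\Gamma[\sigma]\vdash\Delta[\sigma]^W$ when $\sigma$ assigns to each variable of $V$ a term of the same sort with variables in $W$); the right rule for $\top$ and the left rule for $\bot$; the left and right rules for $\wedge$, $\vee$ and $\exists$ (from $\Gamma\vdash\varphi[t/x],\Delta^V$, with $t$ a term with variables in $V$, infer $\Gamma\vdash\exists x\,\varphi,\Delta^V$; from $\varphi,\Gamma\vdash\Delta^{V\cup\{x\}}$,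 with $x\notin V$, infer $\exists x\,\varphi,\Gamma\vdash\Delta^V$); and the equality rules $\vdash t=t^V$ and $t=t',\varphi[t/x]\vdash\varphi[t'/x]^V$. An interpretation $M$ of $L$ assigns to each sort $X$ a (possibly empty) set $X^M$, to each function symbol a function $f^M:X_1^M\times\cdots\times X_n^M\to Y^M$, to each relation symbol a subset $R^M\subseteq X_1^M\times\cdots\times X_n^M$, and to each constant of sort $X$ an element of $X^M$. For a geometric formula $\varphi$ with free variables in $V=\{x_1,\dots,x_n\}$, $x_i$ of sort $X_i$, let $M(\varphi,V)\subseteq X_1^M\times\cdots\times X_n^M$ be the set of tuples at which $\varphi$ holds in $M$. The sequent $\Gamma\vdash\Delta^V$ is *satisfied* in $M$ if $$M\Big(\bigwedge_{\varphi\in\Gamma}\varphi,\,V\Big)\subseteq M\Big(\bigvee_{\psi\in\Delta}\psi,\,V\Big),$$ and $M$ is a *model* of $T$ if every axiom of $T$ is satisfied in $M$. Then, for every geometric theory $T$ and every geometric sequent $\alpha$ of $L$, $$\alpha \text{ is provable in } T \iff \alpha \text{ is satisfied in all (set-valued) models of } T.$$ -/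

import Mathlib

/-!
Many-sorted first-order languages, geometric (coherent) formulas, geometric sequents and theories,
the geometric fragment of Gentzen's sequent calculus, and set-valued models.
-/

universe u w

namespace GeometricLogic

/-- A many-sorted first-order language: sorts, relation symbols `R ⊆ X₁ × ⋯ × Xₙ`, function symbols
`f : X₁ × ⋯ × Xₙ → Y`, and constants. -/
structure Language where
  /-- The sorts. -/
  Sorts : Type u
  /-- The relation symbols. -/
  Rel : Type u
  /-- The number of arguments of a relation symbol. -/
  relArity : Rel → ℕ
  /-- The sorts of the arguments of a relation symbol. -/
  relDom : (R : Rel) → Fin (relArity R) → Sorts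
  /-- The function symbols. -/
  Fun : Type u
  /-- The number of arguments of a function symbol. -/
  funArity : Fun → ℕ
  /-- The sorts of the arguments of a function symbol. -/
  funDom : (f : Fun) → Fin (funArity f) → Sorts
  /-- The sort of the values of a function symbol. -/
  funCod : Fun → Sorts
  /-- The constants. -/
  Const : Type u
  /-- The sort of a constant. -/
  constSort : Const → Sorts

/-- A context: a finite collection `V` of sorted variables, given (up to renaming) by the list of
their sorts. -/
abbrev Ctx (L : Language.{u}) : Type u := List L.Sorts

/-- `Var V X` is the type of variables of sort `X` in the context `V`, that is, of positions in the
list `V` at which `X` occurs. -/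
inductive Var {L : Language.{u}} : Ctx L → L.Sorts → Type u
  | zero {V : Ctx L} {X : L.Sorts} : Var (X :: V) X
  | succ {V : Ctx L} {X Y : L.Sorts} : Var V X → Var (Y :: V) X

/-- Terms of a given sort with variables in the context `V`. -/
inductive Term (L : Language.{u}) (V : Ctx L) : L.Sorts → Type u
  | var {X : L.Sorts} (x : Var V X) : Term L V X
  | const (c : L.Const) : Term L V (L.constSort c)
  | app (f : L.Fun) (t : (i : Fin (L.funArity f)) → Term L V (L.funDom f i)) :
      Term L V (L.funCod f)

/-- Geometric formulas with free variables in the context `V`: built from the atomic formulas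
`R(t₁, …, tₙ)`, `t = t'`, `⊤`, `⊥` by `∧`, `∨` and `∃`. In `ex X φ` the variable of sort `X` that is
bound is the first one of the context `X :: V` of `φ`. -/
inductive Formula (L : Language.{u}) : Ctx L → Type u
  | rel {V : Ctx L} (R : L.Rel) (t : (i : Fin (L.relArity R)) → Term L V (L.relDom R i)) :
      Formula L V
  | eq {V : Ctx L} {X : L.Sorts} (t t' : Term L V X) : Formula L V
  | top {V : Ctx L} : Formula L V
  | bot {V : Ctx L} : Formula L V
  | and {V : Ctx L} (φ ψ : Formula L V) : Formula L V
  | or {V : Ctx L} (φ ψ : Formula L V) : Formula L V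
  | ex {V : Ctx L} (X : L.Sorts) (φ : Formula L (X :: V)) : Formula L V

/-- Equality of formulas is decided classically, so that finite sets of formulas can be formed. -/
noncomputable instance {L : Language.{u}} {V : Ctx L} : DecidableEq (Formula L V) :=
  Classical.decEq _

/-- A geometric sequent `Γ ⊢ Δ` in the context `V`: finite sets `Γ`, `Δ` of geometric formulas with
free variables in `V`. -/
structure Sequent (L : Language.{u}) where
  /-- The context `V`. -/
  ctx : Ctx L
  /-- The hypotheses `Γ`. -/
  ant : Finset (Formula L ctx)
  /-- The conclusions `Δ`. -/
  suc : Finset (Formula L ctx)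

/-- A geometric theory: a set of geometric sequents, its axioms. -/
abbrev Theory (L : Language.{u}) : Type u := Set (Sequent L)

/-! ### Substitution -/

/-- A substitution of terms in the context `W` for the variables of the context `V`. -/
abbrev Subst {L : Language.{u}} (V W : Ctx L) : Type u := (X : L.Sorts) → Var V X → Term L W X

/-- Simultaneous substitution in a term. -/
def Term.subst {L : Language.{u}} {V W : Ctx L} (σ : Subst V W) :
    {X : L.Sorts} → Term L V X → Term L W X
  | _, .var x => σ _ x
  | _, .const c => .const c
  | _, .app f t => .app f fun i => (t i).subst σ

/-- The substitution that regards each variable of `V` as a term in the context `X :: V`. -/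
def Subst.wk {L : Language.{u}} (V : Ctx L) (X : L.Sorts) : Subst V (X :: V) :=
  fun _ x => .var x.succ

/-- The substitution of the term `t` for the first variable of `X :: V`; the others are fixed. -/
def Subst.inst {L : Language.{u}} {V : Ctx L} {X : L.Sorts} (t : Term L V X) : Subst (X :: V) V
  | _, .zero => t
  | _, .succ x => .var x

/-- The extension of a substitution under a quantifier: the bound variable is fixed. -/
def Subst.lift {L : Language.{u}} {V W : Ctx L} (σ : Subst V W) (X : L.Sorts) :
    Subst (X :: V) (X :: W)
  | _, .zero => .var .zero
  | _, .succ x => (σ _ x).subst (Subst.wk W X)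

/-- Simultaneous (capture-avoiding) substitution in a formula. -/
def Formula.subst {L : Language.{u}} : {V W : Ctx L} → Subst V W → Formula L V → Formula L W
  | _, _, σ, .rel R t => .rel R fun i => (t i).subst σ
  | _, _, σ, .eq t t' => .eq (t.subst σ) (t'.subst σ)
  | _, _, _, .top => .top
  | _, _, _, .bot => .bot
  | _, _, σ, .and φ ψ => .and (φ.subst σ) (ψ.subst σ)
  | _, _, σ, .or φ ψ => .or (φ.subst σ) (ψ.subst σ)
  | _, _, σ, .ex X φ => .ex X (φ.subst (σ.lift X))

/-! ### Provability -/

/-- `Derivable T Γ Δ`: the sequent `Γ ⊢ Δ` in the context `V` is derivable from the axioms of `T` by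
the rules of Gentzen's sequent calculus for `⊤`, `⊥`, `∧`, `∨`, `∃` and equality, with the structural
rules (identity, weakening, cut, substitution). Contexts are explicit: a variable can be removed from
the context only by substituting a term for it, and so no sort is assumed to be nonempty. -/
inductive Derivable {L : Language.{u}} (T : Theory L) :
    {V : Ctx L} → Finset (Formula L V) → Finset (Formula L V) → Prop
  | ax (α : Sequent L) : α ∈ T → Derivable T α.ant α.suc
  | id {V : Ctx L} (φ : Formula L V) : Derivable T {φ} {φ}
  | weaken {V : Ctx L} {Γ Γ' Δ Δ' : Finset (Formula L V)} :
      Γ ⊆ Γ' → Δ ⊆ Δ' → Derivable T Γ Δ → Derivable T Γ' Δ'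
  | cut {V : Ctx L} {Γ Δ : Finset (Formula L V)} (φ : Formula L V) :
      Derivable T Γ (insert φ Δ) → Derivable T (insert φ Γ) Δ → Derivable T Γ Δ
  | subst {V W : Ctx L} {Γ Δ : Finset (Formula L V)} (σ : Subst V W) :
      Derivable T Γ Δ → Derivable T (Γ.image (Formula.subst σ)) (Δ.image (Formula.subst σ))
  | topR {V : Ctx L} {Γ Δ : Finset (Formula L V)} : Derivable T Γ (insert .top Δ)
  | botL {V : Ctx L} {Γ Δ : Finset (Formula L V)} : Derivable T (insert .bot Γ) Δ
  | andL {V : Ctx L} {Γ Δ : Finset (Formula L V)} {φ ψ : Formula L V} :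
      Derivable T (insert φ (insert ψ Γ)) Δ → Derivable T (insert (.and φ ψ) Γ) Δ
  | andR {V : Ctx L} {Γ Δ : Finset (Formula L V)} {φ ψ : Formula L V} :
      Derivable T Γ (insert φ Δ) → Derivable T Γ (insert ψ Δ) →
        Derivable T Γ (insert (.and φ ψ) Δ)
  | orL {V : Ctx L} {Γ Δ : Finset (Formula L V)} {φ ψ : Formula L V} :
      Derivable T (insert φ Γ) Δ → Derivable T (insert ψ Γ) Δ →
        Derivable T (insert (.or φ ψ) Γ) Δ
  | orR {V : Ctx L} {Γ Δ : Finset (Formula L V)} {φ ψ : Formula L V} :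
      Derivable T Γ (insert φ (insert ψ Δ)) → Derivable T Γ (insert (.or φ ψ) Δ)
  | exL {V : Ctx L} {Γ Δ : Finset (Formula L V)} {X : L.Sorts} {φ : Formula L (X :: V)} :
      Derivable T (insert φ (Γ.image (Formula.subst (Subst.wk V X))))
          (Δ.image (Formula.subst (Subst.wk V X))) →
        Derivable T (insert (.ex X φ) Γ) Δ
  | exR {V : Ctx L} {Γ Δ : Finset (Formula L V)} {X : L.Sorts} {φ : Formula L (X :: V)}
      (t : Term L V X) :
      Derivable T Γ (insert (φ.subst (Subst.inst t)) Δ) → Derivable T Γ (insert (.ex X φ) Δ)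
  | eqRefl {V : Ctx L} {X : L.Sorts} (t : Term L V X) : Derivable T ∅ {.eq t t}
  | eqSubst {V : Ctx L} {X : L.Sorts} (t t' : Term L V X) (φ : Formula L (X :: V)) :
      Derivable T {.eq t t', φ.subst (Subst.inst t)} {φ.subst (Subst.inst t')}

/-- The sequent `α` is provable in `T`. -/
def Provable {L : Language.{u}} (T : Theory L) (α : Sequent L) : Prop :=
  Derivable T α.ant α.suc

/-! ### Set-valued interpretations and models -/

/-- A set-valued interpretation of `L`. The carrier of a sort may be empty. -/
structure Interpretation (L : Language.{u}) where
  /-- The set that interprets a sort. -/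
  carrier : L.Sorts → Type w
  /-- The function that interprets a function symbol. -/
  funMap : (f : L.Fun) → ((i : Fin (L.funArity f)) → carrier (L.funDom f i)) →
    carrier (L.funCod f)
  /-- The relation that interprets a relation symbol. -/
  relMap : (R : L.Rel) → Set ((i : Fin (L.relArity R)) → carrier (L.relDom R i))
  /-- The element that interprets a constant. -/
  constMap : (c : L.Const) → carrier (L.constSort c)

namespace Interpretation

/-- The product `X₁^M × ⋯ × Xₙ^M` over the variables of the context `V = (X₁, …, Xₙ)`: assignments
of elements of `M` to the variables of `V`. -/
abbrev Val {L : Language.{u}} (M : Interpretation.{u, w} L) (V : Ctx L) : Type (max u w) :=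
  (X : L.Sorts) → Var V X → M.carrier X

/-- The extension of an assignment by the value `a` of a new first variable. -/
def extend {L : Language.{u}} (M : Interpretation.{u, w} L) {V : Ctx L} {X : L.Sorts}
    (a : M.carrier X) (v : M.Val V) : M.Val (X :: V)
  | _, .zero => a
  | _, .succ x => v _ x

/-- The interpretation `t^M` of a term. -/
def term {L : Language.{u}} (M : Interpretation.{u, w} L) {V : Ctx L} :
    {X : L.Sorts} → Term L V X → M.Val V → M.carrier X
  | _, .var x, v => v _ x
  | _, .const c, _ => M.constMap c
  | _, .app f t, v => M.funMap f fun i => M.term (t i) v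

/-- The interpretation `M(φ, V) = {(x₁, …, xₙ) | φ}^M` of a geometric formula. -/
def formula {L : Language.{u}} (M : Interpretation.{u, w} L) :
    {V : Ctx L} → Formula L V → Set (M.Val V)
  | _, .rel R t => {v | (fun i => M.term (t i) v) ∈ M.relMap R}
  | _, .eq t t' => {v | M.term t v = M.term t' v}
  | _, .top => Set.univ
  | _, .bot => ∅
  | _, .and φ ψ => M.formula φ ∩ M.formula ψ
  | _, .or φ ψ => M.formula φ ∪ M.formula ψ
  | _, .ex _ φ => {v | ∃ a, M.extend a v ∈ M.formula φ}

/-- The sequent `Γ ⊢ Δ` in the context `V` is satisfied in `M`: `M(⋀ Γ, V) ⊆ M(⋁ Δ, V)`. -/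
def Satisfies {L : Language.{u}} (M : Interpretation.{u, w} L) (α : Sequent L) : Prop :=
  (⋂ φ ∈ α.ant, M.formula φ) ⊆ ⋃ ψ ∈ α.suc, M.formula ψ

/-- `M` is a model of `T`: it satisfies every axiom of `T`. -/
def IsModel {L : Language.{u}} (M : Interpretation.{u, w} L) (T : Theory L) : Prop :=
  ∀ α ∈ T, M.Satisfies α

end Interpretation

end GeometricLogic

/-!
Soundness is an induction on derivations. Completeness is a Henkin argument adapted to possibly
empty sorts and to the absence of negation and implication.

Fix a sequent `Γ ⊢ Δ` in the context `V₀` that is not derivable. The parameters (`Param`) are the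
variables of `V₀` together with a name `wit φ a` for a witness of each formula `∃ x, φ` at each
assignment `a` of parameters. Since sorts may be empty, a parameter is not assumed to exist from the
start: a state (`Item`, `Admissible`) is a set of declarations that certain parameters exist and that
certain formulas are true, or false, at assignments of existing parameters. It is consistent if no
derivable sequent has, at some assignment of existing parameters, all its hypotheses declared true
and all its conclusions declared false. The sequent `Γ ⊢ Δ` yields a consistent state
(`admissible_initial`), and by compactness and Zorn's lemma this lies in a maximal one
(`Admissible.exists_maximal`). The cut rule makes a maximal state decide every formula
(`pos_or_neg_of_maximal`). The left rule for `∃` makes it contain a witness of every true existential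
formula (`dom_wit_of_maximal`): if `wit φ a` does not exist yet, then nothing has been declared about
it, so it serves as a fresh variable. The step from parameters back to variables uses contexts in
which the assignment is injective (`exists_injective_merge`), where a formula about parameters has a
unique copy.

A maximal state is thus a saturated prime diagram (`Diagram`), and its model is the set of existing
parameters modulo declared equality. Every term `t` has a value, as `∃ y, t = y` is derivable and so
has a witness, and the substitution rule for equality shows that truth of `φ[σ]` is truth of `φ` at
the values of the terms of `σ` (`Diagram.tr_subst`). Hence truth in the model is declared truth
(`Diagram.model_formula`), so all axioms hold in the model and `Γ ⊢ Δ` fails at the assignment of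
each variable of `V₀` to itself.
-/

namespace GeometricLogic

variable {L : Language.{u}}

/-! ### Families over contexts, renamings and the algebra of substitution -/

/-- Families of elements of `C` indexed by the variables of `V`, respecting sorts. Assignments,
substitutions and renamings are the cases `C = M.carrier`, `C = Term L W` and `C = Var W`. -/
abbrev Fam (C : L.Sorts → Type*) (V : Ctx L) := (X : L.Sorts) → Var V X → C X

/-- The extension of a family by a value at a new first variable. -/
def Fam.cons {C : L.Sorts → Type*} {V : Ctx L} {X : L.Sorts} (p : C X) (a : Fam C V) :
    Fam C (X :: V)
  | _, .zero => p
  | _, .succ x => a _ x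

theorem Fam.ext_cons {C : L.Sorts → Type*} {V : Ctx L} {X : L.Sorts} {a b : Fam C (X :: V)}
    (h₀ : a X .zero = b X .zero) (h : ∀ Y (x : Var V Y), a Y x.succ = b Y x.succ) : a = b := by
  funext Y x
  cases x with
  | zero => exact h₀
  | succ x => exact h Y x

theorem Fam.ext_nil {C : L.Sorts → Type*} (a b : Fam C ([] : Ctx L)) : a = b := by
  funext Y x
  cases x

/-- Composition of a family with a sort-preserving map of its values. -/
abbrev Fam.map {C D : L.Sorts → Type*} (g : ∀ X, C X → D X) {V : Ctx L} (a : Fam C V) : Fam D V :=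
  fun X x => g X (a X x)

theorem Fam.map_cons {C D : L.Sorts → Type*} (g : ∀ X, C X → D X) {V : Ctx L} {X : L.Sorts}
    (p : C X) (a : Fam C V) : Fam.map g (Fam.cons p a) = Fam.cons (g X p) (Fam.map g a) :=
  Fam.ext_cons rfl fun _ _ => rfl

/-- A renaming of the variables of `V` by variables of `W`. -/
abbrev Ren (V W : Ctx L) := Fam (Var W) V

/-- A renaming, regarded as a substitution. -/
abbrev Ren.toSubst {V W : Ctx L} (ρ : Ren V W) : Subst V W := fun X x => .var (ρ X x)

/-- The renaming `ρ`, followed by the reading of values in `a`. -/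
abbrev Ren.pull {C : L.Sorts → Type*} {V W : Ctx L} (ρ : Ren V W) (a : Fam C W) : Fam C V :=
  fun X x => a X (ρ X x)

/-- The composite of two substitutions. -/
def Subst.comp {V W U : Ctx L} (σ : Subst V W) (τ : Subst W U) : Subst V U :=
  fun X x => (σ X x).subst τ

/-- The identity renaming. -/
abbrev Ren.id (V : Ctx L) : Ren V V := fun _ x => x

/-- The extension of a renaming under a quantifier. -/
abbrev Ren.lift {V W : Ctx L} (ρ : Ren V W) (X : L.Sorts) : Ren (X :: V) (X :: W) :=
  Fam.cons .zero fun Y x => (ρ Y x).succ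

/-- The inclusion of the variables of `V` into `X :: V`. -/
abbrev Ren.succ (V : Ctx L) (X : L.Sorts) : Ren V (X :: V) := fun _ x => x.succ

theorem Ren.toSubst_succ (V : Ctx L) (X : L.Sorts) : (Ren.succ V X).toSubst = Subst.wk V X := rfl

theorem Ren.toSubst_lift {V W : Ctx L} (ρ : Ren V W) (X : L.Sorts) :
    (ρ.lift X).toSubst = ρ.toSubst.lift X := Fam.ext_cons rfl fun _ _ => rfl

theorem Term.subst_id {V : Ctx L} {X : L.Sorts} (t : Term L V X) :
    t.subst (Ren.id V).toSubst = t := by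
  induction t with
  | var x => rfl
  | const c => rfl
  | app f t ih => simp only [Term.subst, ih]

theorem Term.subst_subst {V W U : Ctx L} (σ : Subst V W) (τ : Subst W U) {X : L.Sorts}
    (t : Term L V X) : (t.subst σ).subst τ = t.subst (σ.comp τ) := by
  induction t with
  | var x => rfl
  | const c => rfl
  | app f t ih => simp only [Term.subst, ih]

theorem Subst.lift_id (V : Ctx L) (X : L.Sorts) :
    (Ren.id V).toSubst.lift X = (Ren.id (X :: V)).toSubst := Fam.ext_cons rfl fun _ _ => rfl

theorem Subst.lift_comp {V W U : Ctx L} (σ : Subst V W) (τ : Subst W U) (X : L.Sorts) :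
    (σ.lift X).comp (τ.lift X) = (σ.comp τ).lift X := by
  refine Fam.ext_cons rfl fun Y x => ?_
  change ((σ Y x).subst _).subst _ = ((σ Y x).subst _).subst _
  rw [Term.subst_subst, Term.subst_subst]
  rfl

theorem Formula.subst_id {V : Ctx L} (φ : Formula L V) : φ.subst (Ren.id V).toSubst = φ := by
  induction φ with
  | rel R t => simp only [Formula.subst, Term.subst_id]
  | eq t t' => simp only [Formula.subst, Term.subst_id]
  | top => rfl
  | bot => rfl
  | and φ ψ h h' => simp only [Formula.subst, h, h']
  | or φ ψ h h' => simp only [Formula.subst, h, h']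
  | ex X φ h => simp only [Formula.subst, Subst.lift_id, h]

theorem Formula.subst_subst {V W U : Ctx L} (σ : Subst V W) (τ : Subst W U) (φ : Formula L V) :
    (φ.subst σ).subst τ = φ.subst (σ.comp τ) := by
  induction φ generalizing W U with
  | rel R t => simp only [Formula.subst, Term.subst_subst]
  | eq t t' => simp only [Formula.subst, Term.subst_subst]
  | top => rfl
  | bot => rfl
  | and φ ψ h h' => simp only [Formula.subst, h, h']
  | or φ ψ h h' => simp only [Formula.subst, h, h']
  | ex X φ h => simp only [Formula.subst, Subst.lift_comp, h]

theorem Term.wk_inst {V : Ctx L} {X Y : L.Sorts} (s : Term L V Y) (t : Term L V X) :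
    (t.subst (Subst.wk V Y)).subst (Subst.inst s) = t := by
  rw [Term.subst_subst]
  exact Term.subst_id t

theorem Formula.lift_wk_inst_zero {V : Ctx L} {X : L.Sorts} (φ : Formula L (X :: V)) :
    (φ.subst ((Subst.wk V X).lift X)).subst (Subst.inst (.var .zero)) = φ := by
  rw [Formula.subst_subst]
  have : ((Subst.wk V X).lift X).comp (Subst.inst (.var .zero)) = (Ren.id (X :: V)).toSubst :=
    Fam.ext_cons rfl fun _ _ => rfl
  rw [this, Formula.subst_id]

/-! ### Soundness -/

namespace Interpretation

variable (M : Interpretation.{u, w} L)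

theorem term_subst {V W : Ctx L} (σ : Subst V W) {X : L.Sorts} (t : Term L V X) (v : M.Val W) :
    M.term (t.subst σ) v = M.term t fun Y x => M.term (σ Y x) v := by
  induction t with
  | var x => rfl
  | const c => rfl
  | app f t ih => simp only [Term.subst, Interpretation.term, ih]

theorem extend_lift {V W : Ctx L} (σ : Subst V W) {X : L.Sorts} (a : M.carrier X) (v : M.Val W) :
    (fun Y x => M.term (σ.lift X Y x) (M.extend a v)) =
      M.extend a fun Y x => M.term (σ Y x) v := by
  refine Fam.ext_cons rfl fun Y x => ?_
  change M.term ((σ Y x).subst _) _ = _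
  rw [term_subst]
  rfl

theorem mem_formula_subst {V W : Ctx L} (σ : Subst V W) (φ : Formula L V) (v : M.Val W) :
    v ∈ M.formula (φ.subst σ) ↔ (fun Y x => M.term (σ Y x) v) ∈ M.formula φ := by
  induction φ generalizing W with
  | rel R t => simp only [Formula.subst, Interpretation.formula, Set.mem_ofPred_eq, term_subst]
  | eq t t' => simp only [Formula.subst, Interpretation.formula, Set.mem_ofPred_eq, term_subst]
  | top => exact Iff.rfl
  | bot => exact Iff.rfl
  | and φ ψ h h' => exact and_congr (h σ v) (h' σ v)
  | or φ ψ h h' => exact or_congr (h σ v) (h' σ v)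
  | ex X φ h => exact exists_congr fun a => by rw [h, extend_lift]

theorem mem_formula_inst {V : Ctx L} {X : L.Sorts} (t : Term L V X) (φ : Formula L (X :: V))
    (v : M.Val V) :
    v ∈ M.formula (φ.subst (Subst.inst t)) ↔ M.extend (M.term t v) v ∈ M.formula φ := by
  rw [mem_formula_subst]
  exact iff_of_eq (congrArg (· ∈ M.formula φ) (Fam.ext_cons rfl fun _ _ => rfl))

theorem satisfies_iff (α : Sequent L) : M.Satisfies α ↔
    ∀ v : M.Val α.ctx, (∀ γ ∈ α.ant, v ∈ M.formula γ) → ∃ δ ∈ α.suc, v ∈ M.formula δ := by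
  simp only [Satisfies, Set.subset_def, Set.mem_iInter, Set.mem_iUnion, exists_prop]

end Interpretation

theorem Derivable.sound {T : Theory L} {M : Interpretation.{u, w} L} (hM : M.IsModel T) {V : Ctx L}
    {Γ Δ : Finset (Formula L V)} (h : Derivable T Γ Δ) (v : M.Val V)
    (hv : ∀ γ ∈ Γ, v ∈ M.formula γ) : ∃ δ ∈ Δ, v ∈ M.formula δ := by
  induction h with
  | ax α hα => exact (M.satisfies_iff α).1 (hM α hα) v hv
  | id φ => exact ⟨φ, by simp, hv φ (by simp)⟩
  | weaken hΓ hΔ _ ih =>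
    obtain ⟨δ, hδ, h⟩ := ih v fun γ hγ => hv γ (hΓ hγ)
    exact ⟨δ, hΔ hδ, h⟩
  | cut φ _ _ ih₁ ih₂ =>
    obtain ⟨δ, hδ, h⟩ := ih₁ v hv
    rcases Finset.mem_insert.1 hδ with rfl | hδ
    · exact ih₂ v (Finset.forall_mem_insert _ _ _ |>.2 ⟨h, hv⟩)
    · exact ⟨δ, hδ, h⟩
  | subst σ _ ih =>
    obtain ⟨δ, hδ, h⟩ := ih (fun Y x => M.term (σ Y x) v) fun γ hγ =>
      (M.mem_formula_subst σ γ v).1 (hv _ (Finset.mem_image_of_mem _ hγ))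
    exact ⟨_, Finset.mem_image_of_mem _ hδ, (M.mem_formula_subst σ δ v).2 h⟩
  | topR => exact ⟨_, Finset.mem_insert_self _ _, Set.mem_univ v⟩
  | botL => exact (hv _ (Finset.mem_insert_self _ _)).elim
  | andL _ ih =>
    obtain ⟨h, hv⟩ := Finset.forall_mem_insert _ _ _ |>.1 hv
    refine ih v ?_
    simp only [Finset.forall_mem_insert]
    exact ⟨h.1, h.2, hv⟩
  | andR _ _ ih₁ ih₂ =>
    obtain ⟨δ, hδ, h⟩ := ih₁ v hv
    obtain ⟨δ', hδ', h'⟩ := ih₂ v hv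
    rcases Finset.mem_insert.1 hδ with rfl | hδ
    · rcases Finset.mem_insert.1 hδ' with rfl | hδ'
      · exact ⟨_, Finset.mem_insert_self _ _, h, h'⟩
      · exact ⟨δ', Finset.mem_insert_of_mem hδ', h'⟩
    · exact ⟨δ, Finset.mem_insert_of_mem hδ, h⟩
  | orL _ _ ih₁ ih₂ =>
    obtain ⟨h | h, hv⟩ := Finset.forall_mem_insert _ _ _ |>.1 hv
    · exact ih₁ v (Finset.forall_mem_insert _ _ _ |>.2 ⟨h, hv⟩)
    · exact ih₂ v (Finset.forall_mem_insert _ _ _ |>.2 ⟨h, hv⟩)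
  | orR _ ih =>
    obtain ⟨δ, hδ, h⟩ := ih v hv
    simp only [Finset.mem_insert] at hδ
    rcases hδ with rfl | rfl | hδ
    · exact ⟨_, Finset.mem_insert_self _ _, Or.inl h⟩
    · exact ⟨_, Finset.mem_insert_self _ _, Or.inr h⟩
    · exact ⟨δ, Finset.mem_insert_of_mem hδ, h⟩
  | exL _ ih =>
    obtain ⟨⟨a, ha⟩, hv⟩ := Finset.forall_mem_insert _ _ _ |>.1 hv
    obtain ⟨δ, hδ, h⟩ := ih (M.extend a v) <| by
      simp only [Finset.forall_mem_insert, Finset.forall_mem_image, M.mem_formula_subst]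
      exact ⟨ha, hv⟩
    obtain ⟨δ, hδ', rfl⟩ := Finset.mem_image.1 hδ
    exact ⟨δ, hδ', (M.mem_formula_subst _ _ _).1 h⟩
  | exR t _ ih =>
    obtain ⟨δ, hδ, h⟩ := ih v hv
    rcases Finset.mem_insert.1 hδ with rfl | hδ
    · exact ⟨_, Finset.mem_insert_self _ _, _, (M.mem_formula_inst _ _ _).1 h⟩
    · exact ⟨δ, Finset.mem_insert_of_mem hδ, h⟩
  | eqRefl t => exact ⟨_, Finset.mem_singleton_self _, rfl⟩
  | eqSubst t t' φ =>
    refine ⟨_, Finset.mem_singleton_self _, (M.mem_formula_inst _ _ _).2 ?_⟩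
    have h : v ∈ M.formula (.eq t t') := hv _ (Finset.mem_insert_self _ _)
    have h' := (M.mem_formula_inst t φ v).1 (hv _ (by simp))
    rwa [show M.term t v = M.term t' v from h] at h'

/-! ### Contexts for the arguments of a symbol, and common contexts -/

/-- The family on the empty context. -/
def Fam.nil {C : L.Sorts → Type*} : Fam C ([] : Ctx L) := fun _ x => nomatch x

/-- The context whose variables have the sorts `d 0, …, d (n - 1)`. -/
def argCtx : (n : ℕ) → (Fin n → L.Sorts) → Ctx L
  | 0, _ => []
  | n + 1, d => d 0 :: argCtx n fun i => d i.succ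

/-- The `i`-th variable of `argCtx n d`. -/
def argVar : (n : ℕ) → (d : Fin n → L.Sorts) → (i : Fin n) → Var (argCtx n d) (d i)
  | 0, _ => fun i => i.elim0
  | _ + 1, d => Fin.cases .zero fun i => (argVar _ (fun i => d i.succ) i).succ

/-- The family on `argCtx n d` whose value at the `i`-th variable is `p i`. -/
def tuple {C : L.Sorts → Type*} : (n : ℕ) → (d : Fin n → L.Sorts) → ((i : Fin n) → C (d i)) →
    Fam C (argCtx n d)
  | 0, _, _ => Fam.nil
  | n + 1, d, p => Fam.cons (p 0) (tuple n (fun i => d i.succ) fun i => p i.succ)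

theorem tuple_argVar {C : L.Sorts → Type*} (n : ℕ) (d : Fin n → L.Sorts)
    (p : (i : Fin n) → C (d i)) (i : Fin n) : tuple n d p (d i) (argVar n d i) = p i := by
  induction n with
  | zero => exact i.elim0
  | succ n ih =>
    cases i using Fin.cases with
    | zero => rfl
    | succ i => exact ih (fun i => d i.succ) (fun i => p i.succ) i

theorem tuple_rel {C D : L.Sorts → Type*} (Q : ∀ X, C X → D X → Prop) (n : ℕ)
    (d : Fin n → L.Sorts) (p : (i : Fin n) → C (d i)) (q : (i : Fin n) → D (d i))
    (h : ∀ i, Q _ (p i) (q i)) (X : L.Sorts) (x : Var (argCtx n d) X) :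
    Q X (tuple n d p X x) (tuple n d q X x) := by
  induction n with
  | zero => cases x
  | succ n ih =>
    cases x with
    | zero => exact h 0
    | succ x => exact ih _ _ _ (fun i => h i.succ) x

/-- A family is injective if it takes different values at different variables of the same sort. -/
def Fam.Injective {C : L.Sorts → Type*} {V : Ctx L} (a : Fam C V) : Prop :=
  ∀ (X : L.Sorts) (x y : Var V X), a X x = a X y → x = y

theorem Fam.Injective.cons {C : L.Sorts → Type*} {V : Ctx L} {a : Fam C V} (ha : a.Injective)
    {X : L.Sorts} {p : C X} (hp : ∀ x, a X x ≠ p) : (Fam.cons p a).Injective := by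
  intro Y x y h
  cases x with
  | zero =>
    cases y with
    | zero => rfl
    | succ y => exact (hp y h.symm).elim
  | succ x =>
    cases y with
    | zero => exact (hp x h).elim
    | succ y => exact congrArg _ (ha _ _ _ h)

/-- A renaming into an injective family is determined by the family that it pulls back. -/
theorem Fam.Injective.ren_eq {C : L.Sorts → Type*} {V W : Ctx L} {b : Fam C W} (hb : b.Injective)
    {ρ ρ' : Ren V W} (h : ρ.pull b = ρ'.pull b) : ρ = ρ' :=
  funext fun X => funext fun x => hb X _ _ (congrFun (congrFun h X) x)

/-- An injective family can be enlarged so that a further family factors through it. All families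
take values in `D`. -/
theorem exists_injective_merge {C : L.Sorts → Type*} (D : ∀ X, C X → Prop) {V W : Ctx L}
    (a : Fam C V) (ha : ∀ X x, D X (a X x)) (b : Fam C W) (hb : ∀ X x, D X (b X x))
    (hinj : b.Injective) :
    ∃ (U : Ctx L) (c : Fam C U) (ρ : Ren V U) (σ : Ren W U), c.Injective ∧ (∀ X x, D X (c X x)) ∧
      ρ.pull c = a ∧ σ.pull c = b := by
  induction V with
  | nil => exact ⟨W, b, Fam.nil, Ren.id W, hinj, hb, Fam.ext_nil _ _, rfl⟩
  | cons X V ih =>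
    obtain ⟨U, c, ρ, σ, hc, hD, hρ, hσ⟩ := ih (fun Y x => a Y x.succ) fun Y x => ha Y x.succ
    have hρ' (Y) (x : Var V Y) : c Y (ρ Y x) = a Y x.succ := congrFun (congrFun hρ Y) x
    by_cases h : ∃ y, c X y = a X .zero
    · obtain ⟨y, hy⟩ := h
      exact ⟨U, c, Fam.cons y ρ, σ, hc, hD, Fam.ext_cons hy hρ', hσ⟩
    · refine ⟨X :: U, Fam.cons (a X .zero) c, ρ.lift X, fun Y x => (σ Y x).succ,
        hc.cons (not_exists.1 h), fun Y x => ?_, Fam.ext_cons rfl hρ', hσ⟩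
      cases x with
      | zero => exact ha X .zero
      | succ x => exact hD Y x

/-- Two families factor through a common injective one. -/
theorem exists_injective_merge₂ {C : L.Sorts → Type*} (D : ∀ X, C X → Prop) {V W : Ctx L}
    (a : Fam C V) (ha : ∀ X x, D X (a X x)) (b : Fam C W) (hb : ∀ X x, D X (b X x)) :
    ∃ (U : Ctx L) (c : Fam C U) (ρ : Ren V U) (σ : Ren W U), c.Injective ∧ (∀ X x, D X (c X x)) ∧
      ρ.pull c = a ∧ σ.pull c = b := by
  obtain ⟨U, c, ρ, -, hc, hD, hρ, -⟩ := exists_injective_merge D b hb Fam.nil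
    (fun _ x => nomatch x) (fun _ x => nomatch x)
  obtain ⟨U', c', τ, σ, hc', hD', hτ, hσ⟩ := exists_injective_merge D a ha c hD hc
  exact ⟨U', c', τ, fun X x => σ X (ρ X x), hc', hD', hτ, by rw [← hρ, ← hσ]⟩

/-! ### The model of a saturated prime diagram -/

/-- A saturated prime diagram of `T`: a truth predicate `Tr` for formulas at assignments of
parameters from `P` that is invariant under renaming of variables, closed under the derivable
sequents (so prime), and in which every true existential formula has a parameter as witness. -/
structure Diagram (T : Theory L) where
  /-- The parameters of a sort. -/
  P : L.Sorts → Type w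
  /-- Truth of a formula at an assignment of parameters. -/
  Tr : {V : Ctx L} → Formula L V → Fam P V → Prop
  closed : ∀ {V : Ctx L} {Γ Δ : Finset (Formula L V)}, Derivable T Γ Δ → ∀ a : Fam P V,
    (∀ γ ∈ Γ, Tr γ a) → ∃ δ ∈ Δ, Tr δ a
  ren : ∀ {V W : Ctx L} (ρ : Ren V W) (φ : Formula L V) (b : Fam P W),
    Tr (φ.subst ρ.toSubst) b ↔ Tr φ (ρ.pull b)
  wit : ∀ {V : Ctx L} {X : L.Sorts} (φ : Formula L (X :: V)) (a : Fam P V),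
    Tr (.ex X φ) a → ∃ p, Tr φ (Fam.cons p a)

namespace Diagram

variable {T : Theory L} (D : Diagram.{u, w} T)

theorem tr_of_derivable {V : Ctx L} {Γ : Finset (Formula L V)} {δ : Formula L V}
    (h : Derivable T Γ {δ}) (a : Fam D.P V) (hΓ : ∀ γ ∈ Γ, D.Tr γ a) : D.Tr δ a := by
  obtain ⟨δ', h', hδ⟩ := D.closed h a hΓ
  rwa [Finset.mem_singleton.1 h'] at hδ

theorem tr_refl {V : Ctx L} {X : L.Sorts} (t : Term L V X) (a : Fam D.P V) : D.Tr (.eq t t) a :=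
  D.tr_of_derivable (.eqRefl t) a (by simp)

theorem tr_inst {V : Ctx L} {X : L.Sorts} {t t' : Term L V X} {a : Fam D.P V}
    (h : D.Tr (.eq t t') a) (φ : Formula L (X :: V)) (hφ : D.Tr (φ.subst (Subst.inst t)) a) :
    D.Tr (φ.subst (Subst.inst t')) a :=
  D.tr_of_derivable (.eqSubst t t' φ) a (by simp [h, hφ])

theorem tr_symm {V : Ctx L} {X : L.Sorts} {t t' : Term L V X} {a : Fam D.P V}
    (h : D.Tr (.eq t t') a) : D.Tr (.eq t' t) a := by
  have := D.tr_inst h (.eq (.var .zero) (t.subst (Subst.wk V X)))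
  simp only [Formula.subst, Term.wk_inst] at this
  exact this (D.tr_refl t a)

theorem tr_trans {V : Ctx L} {X : L.Sorts} {s t t' : Term L V X} {a : Fam D.P V}
    (h : D.Tr (.eq s t) a) (h' : D.Tr (.eq t t') a) : D.Tr (.eq s t') a := by
  have := D.tr_inst h' (.eq (s.subst (Subst.wk V X)) (.var .zero))
  simp only [Formula.subst, Term.wk_inst] at this
  exact this h

theorem tr_ex {V : Ctx L} {X : L.Sorts} {t : Term L V X} {φ : Formula L (X :: V)} {a : Fam D.P V}
    (h : D.Tr (φ.subst (Subst.inst t)) a) : D.Tr (.ex X φ) a := by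
  refine D.tr_of_derivable (Γ := {φ.subst (Subst.inst t)}) ?_ a (by simpa using h)
  exact .exR (Δ := ∅) t (.id _)

/-- The elementary step of replacing terms by equal terms: two substitutions that arise from a
common one by putting terms `t`, `t'` for one further variable, where `t = t'` is true. -/
def Step {V W : Ctx L} (b : Fam D.P W) (σ σ' : Subst V W) : Prop :=
  ∃ (Y : L.Sorts) (ρ : Subst V (Y :: W)) (t t' : Term L W Y), D.Tr (.eq t t') b ∧
    σ = ρ.comp (Subst.inst t) ∧ σ' = ρ.comp (Subst.inst t')

theorem Step.cons {V W : Ctx L} {b : Fam D.P W} {σ σ' : Subst V W} (h : D.Step b σ σ')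
    {X : L.Sorts} (s : Term L W X) : D.Step b (Fam.cons s σ) (Fam.cons s σ') := by
  obtain ⟨Y, ρ, t, t', h, rfl, rfl⟩ := h
  exact ⟨Y, Fam.cons (s.subst (Subst.wk W Y)) ρ, t, t', h,
    Fam.ext_cons (Term.wk_inst t s).symm fun _ _ => rfl,
    Fam.ext_cons (Term.wk_inst t' s).symm fun _ _ => rfl⟩

/-- Pointwise equal substitutions are connected by replacing their terms one variable at a time. -/
theorem reflTransGen_step {V W : Ctx L} {b : Fam D.P W} (σ σ' : Subst V W)
    (h : ∀ X x, D.Tr (.eq (σ X x) (σ' X x)) b) : Relation.ReflTransGen (D.Step b) σ σ' := by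
  induction V with
  | nil => rw [Fam.ext_nil σ σ']
  | cons X V ih =>
    let τ : Subst V W := fun Y x => σ Y x.succ
    let τ' : Subst V W := fun Y x => σ' Y x.succ
    have hσ : σ = Fam.cons (σ X .zero) τ := Fam.ext_cons rfl fun _ _ => rfl
    have hσ' : σ' = Fam.cons (σ' X .zero) τ' := Fam.ext_cons rfl fun _ _ => rfl
    refine Relation.ReflTransGen.head (b := Fam.cons (σ' X .zero) τ) ?_ ?_
    · rw [hσ]
      exact ⟨X, τ.lift X, _, _, h X .zero, Fam.ext_cons rfl fun Y x => (Term.wk_inst _ _).symm,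
        Fam.ext_cons rfl fun Y x => (Term.wk_inst _ _).symm⟩
    · rw [hσ']
      exact (ih τ τ' fun Y x => h Y x.succ).lift _ fun _ _ h => h.cons D _

theorem tr_subst_congr {V W : Ctx L} {b : Fam D.P W} (σ σ' : Subst V W)
    (h : ∀ X x, D.Tr (.eq (σ X x) (σ' X x)) b) (φ : Formula L V) :
    D.Tr (φ.subst σ) b ↔ D.Tr (φ.subst σ') b := by
  have key (σ σ' : Subst V W) (h : Relation.ReflTransGen (D.Step b) σ σ')
      (hφ : D.Tr (φ.subst σ) b) : D.Tr (φ.subst σ') b := by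
    induction h with
    | refl => exact hφ
    | tail _ hs ih =>
      obtain ⟨Y, ρ, t, t', h, rfl, rfl⟩ := hs
      rw [← Formula.subst_subst] at ih ⊢
      exact D.tr_inst h _ ih
  exact ⟨key σ σ' (D.reflTransGen_step σ σ' h),
    key σ' σ (D.reflTransGen_step σ' σ fun X x => D.tr_symm (h X x))⟩

/-- The parameter `q` is a value of the term `t` at the assignment `a`: the equation `t = x` is true,
with `q` the parameter of the new variable `x`. -/
def Ev {V : Ctx L} {X : L.Sorts} (t : Term L V X) (a : Fam D.P V) (q : D.P X) : Prop :=
  D.Tr (.eq (t.subst (Subst.wk V X)) (.var .zero)) (Fam.cons q a)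

theorem exists_ev {V : Ctx L} {X : L.Sorts} (t : Term L V X) (a : Fam D.P V) :
    ∃ q, D.Ev t a q := by
  refine D.wit _ a (D.tr_ex (t := t) ?_)
  simp only [Formula.subst, Term.wk_inst]
  exact D.tr_refl t a

theorem ev_ren {V W : Ctx L} (ρ : Ren V W) {X : L.Sorts} (t : Term L V X) (b : Fam D.P W)
    (q : D.P X) : D.Ev (t.subst ρ.toSubst) b q ↔ D.Ev t (ρ.pull b) q := by
  have h := D.ren (ρ.lift X) (.eq (t.subst (Subst.wk V X)) (.var .zero)) (Fam.cons q b)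
  simp only [Formula.subst, Term.subst_subst] at h
  unfold Ev
  rw [Term.subst_subst]
  refine Iff.trans h (iff_of_eq (congrArg _ (Fam.ext_cons rfl fun _ _ => rfl)))

/-- If the parameter of the variable `y` is a value of `t`, then `t = y` is true, in every context to
which that of `t` is renamed. -/
theorem Ev.tr_eq_var {V W : Ctx L} {X : L.Sorts} {t : Term L V X} {a : Fam D.P V} {q : D.P X}
    (h : D.Ev t a q) (ρ : Ren V W) (c : Fam D.P W) (hρ : ρ.pull c = a) (y : Var W X)
    (hy : c X y = q) : D.Tr (.eq (t.subst ρ.toSubst) (.var y)) c := by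
  have h' := D.ren (Fam.cons y ρ : Ren (X :: V) W) (.eq (t.subst (Subst.wk V X)) (.var .zero)) c
  simp only [Formula.subst, Term.subst_subst] at h'
  refine h'.2 ?_
  subst hρ hy
  rwa [show Ren.pull (Fam.cons y ρ : Ren (X :: V) W) c = Fam.cons (c X y) (ρ.pull c) from
    Fam.ext_cons rfl fun _ _ => rfl]

/-- Truth of `φ[σ]` is truth of `φ` at values of the substituted terms. -/
theorem tr_subst {V W : Ctx L} (σ : Subst V W) (b : Fam D.P W) (a : Fam D.P V)
    (h : ∀ X x, D.Ev (σ X x) b (a X x)) (φ : Formula L V) : D.Tr (φ.subst σ) b ↔ D.Tr φ a := by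
  obtain ⟨U, c, ρ, τ, -, -, rfl, rfl⟩ := exists_injective_merge₂ (fun _ _ => True) a
    (fun _ _ => trivial) b (fun _ _ => trivial)
  rw [← D.ren ρ, ← D.ren τ, Formula.subst_subst]
  exact D.tr_subst_congr _ _ (fun X x => (h X x).tr_eq_var D τ c rfl _ rfl) φ

/-- Equality of parameters in the diagram. -/
def Equal {X : L.Sorts} (p q : D.P X) : Prop :=
  D.Tr (V := [X, X]) (.eq (.var .zero) (.var (.succ .zero)))
    (Fam.cons p (Fam.cons q Fam.nil))

theorem tr_eq {V : Ctx L} {X : L.Sorts} {t t' : Term L V X} {a : Fam D.P V} {q q' : D.P X}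
    (h : D.Ev t a q) (h' : D.Ev t' a q') : D.Tr (.eq t t') a ↔ D.Equal q q' := by
  refine D.tr_subst (Fam.cons t (Fam.cons t' Fam.nil) : Subst [X, X] V) a _ ?_
    (.eq (.var .zero) (.var (.succ .zero)))
  rintro Y (_ | _ | ⟨⟨⟩⟩)
  exacts [h, h']

theorem ev_var {V : Ctx L} {X : L.Sorts} (x : Var V X) (a : Fam D.P V) :
    D.Ev (.var x) a (a X x) := by
  have h := (D.ren (Fam.cons x (Ren.id V) : Ren (X :: V) V) (.eq (.var x.succ) (.var .zero)) a).1
    (D.tr_refl (.var x) a)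
  rwa [show Ren.pull (Fam.cons x (Ren.id V) : Ren (X :: V) V) a = Fam.cons (a X x) a from
    Fam.ext_cons rfl fun _ _ => rfl] at h

theorem equal_of_ev {V : Ctx L} {X : L.Sorts} {t : Term L V X} {a : Fam D.P V} {q q' : D.P X}
    (h : D.Ev t a q) (h' : D.Ev t a q') : D.Equal q q' :=
  (D.tr_eq h h').1 (D.tr_refl t a)

theorem equal_equivalence (X : L.Sorts) : Equivalence (D.Equal (X := X)) where
  refl p := D.equal_of_ev (D.ev_var .zero (Fam.cons p Fam.nil))
    (D.ev_var .zero (Fam.cons p Fam.nil))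
  symm {p q} h := by
    let a : Fam D.P [X, X] := Fam.cons p (Fam.cons q Fam.nil)
    exact (D.tr_eq (D.ev_var (.succ .zero) a) (D.ev_var .zero a)).1
      (D.tr_symm ((D.tr_eq (D.ev_var .zero a) (D.ev_var (.succ .zero) a)).2 h))
  trans {p q r} h h' := by
    let a : Fam D.P [X, X, X] := Fam.cons p (Fam.cons q (Fam.cons r Fam.nil))
    have h₀ := D.ev_var .zero a
    have h₁ := D.ev_var (.succ .zero) a
    have h₂ := D.ev_var (.succ (.succ .zero)) a
    exact (D.tr_eq h₀ h₂).1 (D.tr_trans ((D.tr_eq h₀ h₁).2 h) ((D.tr_eq h₁ h₂).2 h'))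

theorem Ev.of_equal {V : Ctx L} {X : L.Sorts} {t : Term L V X} {a : Fam D.P V} {q q' : D.P X}
    (h : D.Ev t a q) (hq : D.Equal q q') : D.Ev t a q' := by
  refine (D.tr_eq (q := q) (q' := q') ?_ (D.ev_var .zero (Fam.cons q' a))).2 hq
  exact (D.ev_ren (Ren.succ V X) t (Fam.cons q' a) q).2 h

/-- The value of `t[σ]` is the value of `t` at values of the substituted terms. -/
theorem ev_subst {V W : Ctx L} (σ : Subst V W) (b : Fam D.P W) (a : Fam D.P V)
    (h : ∀ X x, D.Ev (σ X x) b (a X x)) {X : L.Sorts} (t : Term L V X) (q : D.P X) :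
    D.Ev (t.subst σ) b q ↔ D.Ev t a q := by
  obtain ⟨q₁, h₁⟩ := D.exists_ev (t.subst σ) b
  obtain ⟨q₂, h₂⟩ := D.exists_ev t a
  have h₃ : D.Ev t a q₁ := by
    refine (D.tr_subst (σ.lift X) (Fam.cons q₁ b) (Fam.cons q₁ a) ?_ _).1 ?_
    · intro Y x
      cases x with
      | zero => exact D.ev_var .zero _
      | succ x => exact (D.ev_ren (Ren.succ W X) (σ Y x) (Fam.cons q₁ b) _).2 (h Y x)
    · have h₄ := h₁
      simp only [Ev, Formula.subst, Term.subst_subst] at h₄ ⊢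
      exact h₄
  exact ⟨fun h => h₃.of_equal D (D.equal_of_ev h₁ h),
    fun h => h₁.of_equal D (D.equal_of_ev h₃ h)⟩

/-- Equality of parameters of a sort, as a setoid. -/
def setoid (X : L.Sorts) : Setoid (D.P X) := ⟨D.Equal, D.equal_equivalence X⟩

/-- The element of the model that a parameter names. -/
def cls {X : L.Sorts} (p : D.P X) : Quotient (D.setoid X) := Quotient.mk _ p

/-- A parameter that names a given element of the model. -/
noncomputable def rep {X : L.Sorts} (r : Quotient (D.setoid X)) : D.P X := Quotient.out r

theorem cls_rep {X : L.Sorts} (r : Quotient (D.setoid X)) : D.cls (D.rep r) = r :=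
  Quotient.out_eq r

theorem cls_eq {X : L.Sorts} {p q : D.P X} : D.cls p = D.cls q ↔ D.Equal p q :=
  Quotient.eq (r := D.setoid X)

/-- The model named by a diagram: its elements are the parameters up to equality; a symbol applied
to the variables of its argument context is interpreted as the diagram prescribes. -/
noncomputable def model : Interpretation.{u, w} L where
  carrier X := Quotient (D.setoid X)
  funMap f r := D.cls (D.exists_ev (.app f fun i => .var (argVar _ _ i))
    (tuple _ (L.funDom f) fun i => D.rep (r i))).choose
  relMap R := {r | D.Tr (.rel R fun i => .var (argVar _ _ i))
    (tuple _ (L.relDom R) fun i => D.rep (r i))}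
  constMap c := D.cls (D.exists_ev (.const c) Fam.nil).choose

/-- The assignment in the model that an assignment of parameters names. -/
def val {V : Ctx L} (a : Fam D.P V) : D.model.Val V := fun X x => D.cls (a X x)

theorem extend_val {V : Ctx L} {X : L.Sorts} (p : D.P X) (a : Fam D.P V) :
    D.model.extend (X := X) (D.cls p) (D.val a) = D.val (Fam.cons p a) :=
  Fam.ext_cons rfl fun _ _ => rfl

/-- Substitution of terms for the variables of an argument context, at representatives of the
classes of their values. -/
theorem ev_tuple {V : Ctx L} (a : Fam D.P V) (n : ℕ) (d : Fin n → L.Sorts)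
    (t : (i : Fin n) → Term L V (d i)) (q : (i : Fin n) → D.P (d i))
    (h : ∀ i, D.Ev (t i) a (q i)) (X : L.Sorts) (x : Var (argCtx n d) X) :
    D.Ev (tuple n d t X x) a (tuple n d (fun i => D.rep (D.cls (q i))) X x) :=
  tuple_rel (C := Term L V) (D := D.P) (fun _ t q => D.Ev t a q) n d t (fun i => D.rep (D.cls (q i)))
    (fun i => (h i).of_equal D (D.cls_eq.1 (D.cls_rep (D.cls (q i))).symm)) X x

theorem model_term {V : Ctx L} {X : L.Sorts} (t : Term L V X) (a : Fam D.P V) (q : D.P X)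
    (h : D.Ev t a q) : D.model.term t (D.val a) = D.cls q := by
  induction t with
  | var x => exact D.cls_eq.2 (D.equal_of_ev (D.ev_var x a) h)
  | const c =>
    refine D.cls_eq.2 (D.equal_of_ev (D.exists_ev (.const c) Fam.nil).choose_spec ?_)
    exact (D.ev_subst (V := []) Fam.nil a Fam.nil (fun _ x => nomatch x) (.const c) q).1 h
  | app f t ih =>
    choose p hp using fun i => D.exists_ev (t i) a
    simp only [Interpretation.term, fun i => ih i (p i) (hp i)]
    refine D.cls_eq.2 (D.equal_of_ev (D.exists_ev _ _).choose_spec ?_)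
    refine (D.ev_subst (tuple _ _ t) a _ (D.ev_tuple a _ _ t p hp) _ q).1 ?_
    simpa only [Term.subst, tuple_argVar] using h

theorem model_formula {V : Ctx L} (φ : Formula L V) (a : Fam D.P V) :
    D.val a ∈ D.model.formula φ ↔ D.Tr φ a := by
  induction φ with
  | rel R t =>
    choose p hp using fun i => D.exists_ev (t i) a
    have h := D.tr_subst (tuple _ _ t) a _ (D.ev_tuple a _ _ t p hp)
      (.rel R fun i => .var (argVar _ _ i))
    simp only [Formula.subst, Term.subst, tuple_argVar] at h
    refine Iff.trans (iff_of_eq (congrArg (· ∈ D.model.relMap R) ?_)) h.symm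
    exact funext fun i => D.model_term (t i) a _ (hp i)
  | eq t t' =>
    obtain ⟨q, h⟩ := D.exists_ev t a
    obtain ⟨q', h'⟩ := D.exists_ev t' a
    rw [D.tr_eq h h', ← D.cls_eq, ← D.model_term t a q h, ← D.model_term t' a q' h']
    rfl
  | top => exact iff_of_true trivial (D.tr_of_derivable (Γ := ∅) (.topR (Δ := ∅)) a (by simp))
  | bot =>
    refine iff_of_false id fun h => ?_
    obtain ⟨δ, hδ, -⟩ := D.closed (Γ := {.bot}) (Δ := ∅) (.botL (Γ := ∅)) a (by simpa using h)
    simp at hδ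
  | and φ ψ hφ hψ =>
    refine (and_congr (hφ a) (hψ a)).trans ⟨fun h => ?_, fun h => ⟨?_, ?_⟩⟩
    · exact D.tr_of_derivable (Γ := {φ, ψ}) (.andR (Δ := ∅) (.weaken (by simp) subset_rfl (.id φ))
        (.weaken (by simp) subset_rfl (.id ψ))) a (by simp [h.1, h.2])
    · exact D.tr_of_derivable (Γ := {.and φ ψ}) (.andL (Γ := ∅) (.weaken (by simp) subset_rfl
        (.id φ))) a (by simpa using h)
    · exact D.tr_of_derivable (Γ := {.and φ ψ}) (.andL (Γ := ∅) (.weaken (by simp) subset_rfl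
        (.id ψ))) a (by simpa using h)
  | or φ ψ hφ hψ =>
    refine (or_congr (hφ a) (hψ a)).trans ⟨fun h => h.elim (fun h => ?_) fun h => ?_, fun h => ?_⟩
    · exact D.tr_of_derivable (Γ := {φ}) (.orR (Δ := ∅) (.weaken subset_rfl (by simp)
        (.id φ))) a (by simpa using h)
    · exact D.tr_of_derivable (Γ := {ψ}) (.orR (Δ := ∅) (.weaken subset_rfl (by simp)
        (.id ψ))) a (by simpa using h)
    · have := D.closed (Γ := {.or φ ψ}) (Δ := {φ, ψ}) (.orL (Γ := ∅) (.weaken subset_rfl (by simp)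
        (.id φ)) (.weaken subset_rfl (by simp) (.id ψ))) a (by simpa using h)
      simpa using this
  | @ex V X φ ih =>
    constructor
    · rintro ⟨r, hr⟩
      obtain ⟨p, rfl⟩ : ∃ p, D.cls p = r := ⟨D.rep r, D.cls_rep r⟩
      rw [D.extend_val, ih] at hr
      refine (D.ren (Ren.succ V X) (.ex X φ) (Fam.cons p a)).1 ?_
      refine D.tr_ex (t := .var .zero) ?_
      rwa [Ren.toSubst_succ, Formula.lift_wk_inst_zero]
    · intro h
      obtain ⟨p, hp⟩ := D.wit φ a h
      refine ⟨D.cls p, ?_⟩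
      rw [D.extend_val, ih]
      exact hp

theorem model_satisfies_iff (α : Sequent L) : D.model.Satisfies α ↔
    ∀ a : Fam D.P α.ctx, (∀ γ ∈ α.ant, D.Tr γ a) → ∃ δ ∈ α.suc, D.Tr δ a := by
  rw [Interpretation.satisfies_iff]
  simp only [← D.model_formula]
  refine ⟨fun h a => h _, fun h v => ?_⟩
  have hv : v = D.val fun X x => D.rep (v X x) :=
    funext fun X => funext fun x => (D.cls_rep (v X x)).symm
  rw [hv]
  exact h _

theorem model_isModel : D.model.IsModel T := fun α hα =>
  (D.model_satisfies_iff α).2 fun a h => D.closed (.ax α hα) a h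

end Diagram

/-! ### Consistent states -/

/-- The parameters of the Henkin construction over the context `V₀`: the variables of `V₀`, and for
each formula `∃ x, φ` and each assignment of parameters to its free variables a name for a
witness. -/
inductive Param (V₀ : Ctx L) : L.Sorts → Type (max u w)
  | base {X : L.Sorts} (x : Var V₀ X) : Param V₀ X
  | wit {V : Ctx L} {X : L.Sorts} (φ : Formula L (X :: V))
      (a : (Y : L.Sorts) → Var V Y → Param V₀ Y) : Param V₀ X

/-- The atomic pieces of information in a state: a parameter exists, or a formula is declared true
or false at an assignment of parameters. -/
inductive Item (V₀ : Ctx L) : Type (max u w)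
  | dom {X : L.Sorts} (p : Param.{u, w} V₀ X)
  | pos {V : Ctx L} (φ : Formula L V) (a : Fam (Param.{u, w} V₀) V)
  | neg {V : Ctx L} (φ : Formula L V) (a : Fam (Param.{u, w} V₀) V)

variable {V₀ : Ctx L}

/-- The state `A` declares `γ` true at `b`, up to a renaming of variables. -/
def PosAt (A : Set (Item.{u, w} V₀)) {W : Ctx L} (b : Fam (Param.{u, w} V₀) W)
    (γ : Formula L W) : Prop :=
  ∃ (V : Ctx L) (φ : Formula L V) (ρ : Ren V W), .pos φ (ρ.pull b) ∈ A ∧ φ.subst ρ.toSubst = γ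

/-- The state `A` declares `γ` false at `b`, up to a renaming of variables. -/
def NegAt (A : Set (Item.{u, w} V₀)) {W : Ctx L} (b : Fam (Param.{u, w} V₀) W)
    (γ : Formula L W) : Prop :=
  ∃ (V : Ctx L) (φ : Formula L V) (ρ : Ren V W), .neg φ (ρ.pull b) ∈ A ∧ φ.subst ρ.toSubst = γ

/-- The sequent `Γ ⊢ Δ` is refuted by the state `A` at the assignment `b`. -/
structure Refuted (A : Set (Item.{u, w} V₀)) {W : Ctx L} (b : Fam (Param.{u, w} V₀) W)
    (Γ Δ : Finset (Formula L W)) : Prop where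
  dom : ∀ X (x : Var W X), .dom (b X x) ∈ A
  pos : ∀ γ ∈ Γ, PosAt A b γ
  neg : ∀ δ ∈ Δ, NegAt A b δ

/-- A state is consistent if it refutes no derivable sequent. -/
def Consistent (T : Theory L) (A : Set (Item.{u, w} V₀)) : Prop :=
  ∀ (W : Ctx L) (b : Fam (Param.{u, w} V₀) W) (Γ Δ : Finset (Formula L W)),
    Derivable T Γ Δ → ¬ Refuted A b Γ Δ

/-- A state is admissible if it is consistent, its formulas are evaluated at existing parameters
only, and an existing witness of `∃ x, φ` satisfies `φ`. -/
structure Admissible (T : Theory L) (A : Set (Item.{u, w} V₀)) : Prop where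
  consistent : Consistent T A
  dom_of_pos : ∀ {V : Ctx L} (φ : Formula L V) (a : Fam (Param.{u, w} V₀) V), .pos φ a ∈ A →
    ∀ X x, .dom (a X x) ∈ A
  dom_of_neg : ∀ {V : Ctx L} (φ : Formula L V) (a : Fam (Param.{u, w} V₀) V), .neg φ a ∈ A →
    ∀ X x, .dom (a X x) ∈ A
  pos_of_wit : ∀ {V : Ctx L} {X : L.Sorts} (φ : Formula L (X :: V)) (a : Fam (Param.{u, w} V₀) V),
    .dom (.wit φ a) ∈ A → .pos φ (Fam.cons (.wit φ a) a) ∈ A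

section

variable {A B : Set (Item.{u, w} V₀)} {W U : Ctx L} {b : Fam (Param.{u, w} V₀) W}

theorem PosAt.mono {γ : Formula L W} (h : PosAt A b γ) (hAB : A ⊆ B) : PosAt B b γ := by
  obtain ⟨V, φ, ρ, h, rfl⟩ := h
  exact ⟨V, φ, ρ, hAB h, rfl⟩

theorem NegAt.mono {γ : Formula L W} (h : NegAt A b γ) (hAB : A ⊆ B) : NegAt B b γ := by
  obtain ⟨V, φ, ρ, h, rfl⟩ := h
  exact ⟨V, φ, ρ, hAB h, rfl⟩

theorem Refuted.mono {Γ Δ : Finset (Formula L W)} (h : Refuted A b Γ Δ) (hAB : A ⊆ B) :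
    Refuted B b Γ Δ :=
  ⟨fun X x => hAB (h.dom X x), fun γ hγ => (h.pos γ hγ).mono hAB,
    fun δ hδ => (h.neg δ hδ).mono hAB⟩

theorem PosAt.rename {γ : Formula L W} {c : Fam (Param.{u, w} V₀) U} (σ : Ren W U)
    (h : PosAt A (σ.pull c) γ) : PosAt A c (γ.subst σ.toSubst) := by
  obtain ⟨V, φ, ρ, h, rfl⟩ := h
  exact ⟨V, φ, fun X x => σ X (ρ X x), h,
    (Formula.subst_subst ρ.toSubst σ.toSubst φ).symm⟩

theorem NegAt.rename {γ : Formula L W} {c : Fam (Param.{u, w} V₀) U} (σ : Ren W U)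
    (h : NegAt A (σ.pull c) γ) : NegAt A c (γ.subst σ.toSubst) := by
  obtain ⟨V, φ, ρ, h, rfl⟩ := h
  exact ⟨V, φ, fun X x => σ X (ρ X x), h,
    (Formula.subst_subst ρ.toSubst σ.toSubst φ).symm⟩

theorem Refuted.rename {Γ Δ : Finset (Formula L W)} {c : Fam (Param.{u, w} V₀) U} (σ : Ren W U)
    (h : Refuted A (σ.pull c) Γ Δ) (hc : ∀ X x, .dom (c X x) ∈ A) :
    Refuted A c (Γ.image (Formula.subst σ.toSubst)) (Δ.image (Formula.subst σ.toSubst)) :=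
  ⟨hc, Finset.forall_mem_image.2 fun γ hγ => (h.pos γ hγ).rename σ,
    Finset.forall_mem_image.2 fun δ hδ => (h.neg δ hδ).rename σ⟩

instance Var.finite_sigma (W : Ctx L) : Finite (Σ X, Var W X) := by
  induction W with
  | nil => exact @Finite.of_subsingleton _ ⟨fun x => nomatch x.2⟩
  | cons X W ih =>
    refine Finite.of_surjective (α := Option (Σ X, Var W X))
      (fun o => o.elim ⟨X, .zero⟩ fun x => ⟨x.1, x.2.succ⟩) ?_
    rintro ⟨Y, x⟩
    cases x with
    | zero => exact ⟨none, rfl⟩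
    | succ x => exact ⟨some ⟨Y, x⟩, rfl⟩

/-- A refutation uses only finitely many items. -/
theorem Refuted.exists_finite {Γ Δ : Finset (Formula L W)} (h : Refuted A b Γ Δ) :
    ∃ F : Set (Item.{u, w} V₀), F.Finite ∧ F ⊆ A ∧ Refuted F b Γ Δ := by
  choose Vp φp ρp hp hp' using h.pos
  choose Vn φn ρn hn hn' using h.neg
  refine ⟨Set.range (fun x : Σ X, Var W X => .dom (b x.1 x.2)) ∪
    (Set.range (fun γ : Γ => .pos (φp γ γ.2) ((ρp γ γ.2).pull b)) ∪
      Set.range (fun δ : Δ => .neg (φn δ δ.2) ((ρn δ δ.2).pull b))),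
    (Set.finite_range _).union ((Set.finite_range _).union (Set.finite_range _)), ?_, ?_, ?_, ?_⟩
  · rintro _ (⟨x, rfl⟩ | ⟨γ, rfl⟩ | ⟨δ, rfl⟩)
    exacts [h.dom _ _, hp γ γ.2, hn δ δ.2]
  · exact fun X x => Or.inl ⟨⟨X, x⟩, rfl⟩
  · exact fun γ hγ => ⟨_, φp γ hγ, ρp γ hγ, Or.inr (Or.inl ⟨⟨γ, hγ⟩, rfl⟩), hp' γ hγ⟩
  · exact fun δ hδ => ⟨_, φn δ hδ, ρn δ hδ, Or.inr (Or.inr ⟨⟨δ, hδ⟩, rfl⟩), hn' δ hδ⟩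

/-- Beyond what `A` declares, adding `φ` at `a` declares true only the copies of `φ` under renamings
that carry `b` to `a`. -/
theorem PosAt.of_insert_pos {γ : Formula L W} {V : Ctx L} {φ : Formula L V}
    {a : Fam (Param.{u, w} V₀) V} (h : PosAt (insert (.pos φ a) A) b γ) :
    PosAt A b γ ∨ ∃ ρ : Ren V W, ρ.pull b = a ∧ φ.subst ρ.toSubst = γ := by
  obtain ⟨V', φ', ρ, h | h, rfl⟩ := h
  · simp only [Item.pos.injEq] at h
    obtain ⟨rfl, h, h'⟩ := h
    obtain rfl := eq_of_heq h
    exact Or.inr ⟨ρ, eq_of_heq h', rfl⟩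
  · exact Or.inl ⟨V', φ', ρ, h, rfl⟩

theorem NegAt.of_insert_neg {γ : Formula L W} {V : Ctx L} {φ : Formula L V}
    {a : Fam (Param.{u, w} V₀) V} (h : NegAt (insert (.neg φ a) A) b γ) :
    NegAt A b γ ∨ ∃ ρ : Ren V W, ρ.pull b = a ∧ φ.subst ρ.toSubst = γ := by
  obtain ⟨V', φ', ρ, h | h, rfl⟩ := h
  · simp only [Item.neg.injEq] at h
    obtain ⟨rfl, h, h'⟩ := h
    obtain rfl := eq_of_heq h
    exact Or.inr ⟨ρ, eq_of_heq h', rfl⟩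
  · exact Or.inl ⟨V', φ', ρ, h, rfl⟩

theorem PosAt.of_insert {γ : Formula L W} {i : Item.{u, w} V₀} (h : PosAt (insert i A) b γ)
    (hi : ∀ (V : Ctx L) (φ : Formula L V) (a : Fam (Param.{u, w} V₀) V), .pos φ a ≠ i) :
    PosAt A b γ := by
  obtain ⟨V, φ, ρ, h, rfl⟩ := h
  exact ⟨V, φ, ρ, h.resolve_left (hi _ _ _), rfl⟩

theorem NegAt.of_insert {γ : Formula L W} {i : Item.{u, w} V₀} (h : NegAt (insert i A) b γ)
    (hi : ∀ (V : Ctx L) (φ : Formula L V) (a : Fam (Param.{u, w} V₀) V), .neg φ a ≠ i) :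
    NegAt A b γ := by
  obtain ⟨V, φ, ρ, h, rfl⟩ := h
  exact ⟨V, φ, ρ, h.resolve_left (hi _ _ _), rfl⟩

theorem PosAt.of_mem {γ : Formula L W} (h : .pos γ b ∈ A) : PosAt A b γ :=
  ⟨W, γ, Ren.id W, h, γ.subst_id⟩

theorem NegAt.of_mem {γ : Formula L W} (h : .neg γ b ∈ A) : NegAt A b γ :=
  ⟨W, γ, Ren.id W, h, γ.subst_id⟩

end

section

variable {T : Theory L}

theorem Admissible.sUnion {c : Set (Set (Item.{u, w} V₀))} (hc : IsChain (· ⊆ ·) c)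
    (hne : c.Nonempty) (h : ∀ A ∈ c, Admissible T A) : Admissible T (⋃₀ c) where
  consistent W b Γ Δ hd hr := by
    obtain ⟨F, hF, hFc, hr⟩ := hr.exists_finite
    obtain ⟨A, hA, hFA⟩ := DirectedOn.exists_mem_subset_of_finite_of_subset_sUnion hne
      hc.directedOn hF hFc
    exact (h A hA).consistent W b Γ Δ hd (hr.mono hFA)
  dom_of_pos φ a := by
    rintro ⟨A, hA, hφ⟩ X x
    exact ⟨A, hA, (h A hA).dom_of_pos φ a hφ X x⟩
  dom_of_neg φ a := by
    rintro ⟨A, hA, hφ⟩ X x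
    exact ⟨A, hA, (h A hA).dom_of_neg φ a hφ X x⟩
  pos_of_wit φ a := by
    rintro ⟨A, hA, hφ⟩
    exact ⟨A, hA, (h A hA).pos_of_wit φ a hφ⟩

/-- Compactness and Zorn's lemma: every admissible state is contained in a maximal one. -/
theorem Admissible.exists_maximal {A : Set (Item.{u, w} V₀)} (h : Admissible T A) :
    ∃ B, A ⊆ B ∧ Maximal (Admissible T) B :=
  zorn_subset_nonempty {A | Admissible T A}
    (fun _ hc hch hne => ⟨_, Admissible.sUnion hch hne hc, fun _ => Set.subset_sUnion_of_mem⟩) A h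

/-- The state that declares the hypotheses of a sequent true and its conclusions false. -/
inductive initial (Γ Δ : Finset (Formula L V₀)) : Set (Item.{u, w} V₀)
  | dom {X : L.Sorts} (x : Var V₀ X) : initial Γ Δ (.dom (.base x))
  | pos {γ : Formula L V₀} (h : γ ∈ Γ) : initial Γ Δ (.pos γ fun _ x => .base x)
  | neg {δ : Formula L V₀} (h : δ ∈ Δ) : initial Γ Δ (.neg δ fun _ x => .base x)

/-- Consistency of the initial state: since it mentions only the variables of `V₀`, a derivable sequent
that it refutes becomes, by substitution and weakening, a derivation of `Γ ⊢ Δ`. -/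
theorem admissible_initial {Γ Δ : Finset (Formula L V₀)} (h : ¬ Derivable T Γ Δ) :
    Admissible T (initial.{u, w} Γ Δ) where
  consistent W b Γ' Δ' hd hr := by
    have hb (X) (x : Var W X) : ∃ y : Var V₀ X, b X x = .base y := by
      have hx := hr.dom X x
      generalize b X x = p at hx
      cases hx with
      | dom y => exact ⟨y, rfl⟩
    choose ρ hρ using hb
    -- `ρ` reads every variable of `W` as a variable of `V₀`, and it inverts the renamings from `V₀`
    -- by which `b` evaluates the formulas of `Γ` and `Δ`.
    let ρ' : Ren W V₀ := ρ
    have hid (σ : Ren V₀ W) (hσ : σ.pull b = fun _ x => .base x) (φ : Formula L V₀) :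
        (φ.subst σ.toSubst).subst ρ'.toSubst = φ := by
      have : σ.toSubst.comp ρ'.toSubst = (Ren.id V₀).toSubst := by
        funext X x
        have := (hρ X (σ X x)).symm.trans (congrFun (congrFun hσ X) x)
        exact congrArg _ (Param.base.inj this)
      rw [Formula.subst_subst, this, Formula.subst_id]
    refine h (.weaken (Finset.image_subset_iff.2 fun γ hγ => ?_)
      (Finset.image_subset_iff.2 fun δ hδ => ?_) (hd.subst ρ'.toSubst))
    · obtain ⟨V, φ, σ, h, rfl⟩ := hr.pos γ hγ
      generalize hs : σ.pull b = s at h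
      cases h with
      | pos h => rwa [hid σ hs]
    · obtain ⟨V, φ, σ, h, rfl⟩ := hr.neg δ hδ
      generalize hs : σ.pull b = s at h
      cases h with
      | neg h => rwa [hid σ hs]
  dom_of_pos φ a h X x := by
    cases h
    exact .dom x
  dom_of_neg φ a h X x := by
    cases h
    exact .dom x
  pos_of_wit φ a h := nomatch h

/-! ### Maximal states -/

/-- The cut rule: a formula cannot be inconsistent both as true and as false. -/
theorem Consistent.insert_pos_or_neg {A : Set (Item.{u, w} V₀)} (hA : Consistent T A) {V : Ctx L}
    (φ : Formula L V) (a : Fam (Param.{u, w} V₀) V) (ha : ∀ X x, .dom (a X x) ∈ A) :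
    Consistent T (insert (.pos φ a) A) ∨ Consistent T (insert (.neg φ a) A) := by
  by_contra! h
  simp only [Consistent, not_forall, not_not] at h
  obtain ⟨⟨W₁, b₁, Γ₁, Δ₁, hd₁, hr₁⟩, W₂, b₂, Γ₂, Δ₂, hd₂, hr₂⟩ := h
  -- In a context with injective assignment the formula `φ` has a unique copy, which can be cut.
  obtain ⟨U₁, c₁, ρ₁, ρ₂, -, hc₁, rfl, rfl⟩ := exists_injective_merge₂
    (fun X (p : Param.{u, w} V₀ X) => .dom p ∈ A) b₁
    (fun X x => (hr₁.dom X x).resolve_left nofun) b₂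
    (fun X x => (hr₂.dom X x).resolve_left nofun)
  obtain ⟨U, c, τ, σ, hinj, hc, rfl, rfl⟩ := exists_injective_merge₂
    (fun X (p : Param.{u, w} V₀ X) => .dom p ∈ A) a ha c₁ hc₁
  replace hr₁ := hr₁.rename (c := c) (fun X x => σ X (ρ₁ X x)) fun X x => Or.inr (hc X x)
  replace hr₂ := hr₂.rename (c := c) (fun X x => σ X (ρ₂ X x)) fun X x => Or.inr (hc X x)
  replace hd₁ := hd₁.subst (Ren.toSubst fun X x => σ X (ρ₁ X x))
  replace hd₂ := hd₂.subst (Ren.toSubst fun X x => σ X (ρ₂ X x))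
  generalize Γ₁.image (Formula.subst (Ren.toSubst fun X x => σ X (ρ₁ X x))) = Γ₁ at hr₁ hd₁
  generalize Γ₂.image (Formula.subst (Ren.toSubst fun X x => σ X (ρ₂ X x))) = Γ₂ at hr₂ hd₂
  generalize Δ₁.image (Formula.subst (Ren.toSubst fun X x => σ X (ρ₁ X x))) = Δ₁ at hr₁ hd₁
  generalize Δ₂.image (Formula.subst (Ren.toSubst fun X x => σ X (ρ₂ X x))) = Δ₂ at hr₂ hd₂
  have : DecidablePred (PosAt A c) := Classical.decPred _
  have : DecidablePred (NegAt A c) := Classical.decPred _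
  refine hA U c ((Γ₁ ∪ Γ₂).filter (PosAt A c)) ((Δ₁ ∪ Δ₂).filter (NegAt A c))
    (.cut (φ.subst τ.toSubst) (hd₂.weaken ?_ ?_) (hd₁.weaken ?_ ?_))
    ⟨hc, by simp, by simp⟩
  · intro γ hγ
    have := (hr₂.pos γ hγ).of_insert nofun
    simp [hγ, this]
  · intro δ hδ
    obtain h | ⟨ρ, hρ, rfl⟩ := (hr₂.neg δ hδ).of_insert_neg
    · simp [hδ, h]
    · simp [hinj.ren_eq hρ]
  · intro γ hγ
    obtain h | ⟨ρ, hρ, rfl⟩ := (hr₁.pos γ hγ).of_insert_pos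
    · simp [hγ, h]
    · simp [hinj.ren_eq hρ]
  · intro δ hδ
    have := (hr₁.neg δ hδ).of_insert nofun
    simp [hδ, this]

/-- A maximal state decides every formula at existing parameters. -/
theorem pos_or_neg_of_maximal {A : Set (Item.{u, w} V₀)} (hA : Maximal (Admissible T) A) {V : Ctx L}
    (φ : Formula L V) (a : Fam (Param.{u, w} V₀) V) (ha : ∀ X x, .dom (a X x) ∈ A) :
    .pos φ a ∈ A ∨ .neg φ a ∈ A := by
  refine (hA.prop.consistent.insert_pos_or_neg φ a ha).imp (fun h => ?_) fun h => ?_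
  · refine hA.le_of_ge (y := insert (.pos φ a) A) ⟨h, ?_, ?_, ?_⟩ (Set.subset_insert _ _)
      (Set.mem_insert _ _)
    · rintro V' φ' a' (h | h) X x
      · simp only [Item.pos.injEq] at h
        obtain ⟨rfl, -, h⟩ := h
        obtain rfl := eq_of_heq h
        exact Or.inr (ha X x)
      · exact Or.inr (hA.prop.dom_of_pos φ' a' h X x)
    · rintro V' φ' a' (h | h) X x
      · cases h
      · exact Or.inr (hA.prop.dom_of_neg φ' a' h X x)
    · rintro V' X φ' a' (h | h)
      · cases h
      · exact Or.inr (hA.prop.pos_of_wit φ' a' h)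
  · refine hA.le_of_ge (y := insert (.neg φ a) A) ⟨h, ?_, ?_, ?_⟩ (Set.subset_insert _ _)
      (Set.mem_insert _ _)
    · rintro V' φ' a' (h | h) X x
      · cases h
      · exact Or.inr (hA.prop.dom_of_pos φ' a' h X x)
    · rintro V' φ' a' (h | h) X x
      · simp only [Item.neg.injEq] at h
        obtain ⟨rfl, -, h⟩ := h
        obtain rfl := eq_of_heq h
        exact Or.inr (ha X x)
      · exact Or.inr (hA.prop.dom_of_neg φ' a' h X x)
    · rintro V' X φ' a' (h | h)
      · cases h
      · exact Or.inr (hA.prop.pos_of_wit φ' a' h)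

/-- A family all of whose values are `p` or satisfy `D` factors through a context in which `p` is
the value of the first variable and the other values satisfy `D`. -/
theorem exists_split {C : L.Sorts → Type*} (D : ∀ X, C X → Prop) {X : L.Sorts} (p : C X) {W : Ctx L}
    (b : Fam C W) (hb : ∀ Y y, (⟨Y, b Y y⟩ : Σ Y, C Y) = ⟨X, p⟩ ∨ D Y (b Y y)) :
    ∃ (U : Ctx L) (c : Fam C U) (ρ : Ren W (X :: U)), (∀ Y y, D Y (c Y y)) ∧
      ρ.pull (Fam.cons p c) = b := by
  induction W with
  | nil => exact ⟨[], Fam.nil, Fam.nil, fun _ x => (nomatch x), Fam.ext_nil _ _⟩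
  | cons Y W ih =>
    obtain ⟨U, c, ρ, hc, hρ⟩ := ih (fun Z x => b Z x.succ) fun Z x => hb Z x.succ
    have hρ' (Z) (x : Var W Z) : Fam.cons p c Z (ρ Z x) = b Z x.succ :=
      congrFun (congrFun hρ Z) x
    rcases hb Y .zero with h | h
    · obtain ⟨rfl, h⟩ := Sigma.mk.inj h
      exact ⟨U, c, Fam.cons .zero ρ, hc, Fam.ext_cons (eq_of_heq h).symm hρ'⟩
    · refine ⟨Y :: U, Fam.cons (b Y .zero) c, Fam.cons (.succ .zero) fun Z x =>
        (Fam.cons .zero fun _ z => z.succ.succ : Ren (X :: U) (X :: Y :: U)) Z (ρ Z x), ?_,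
        Fam.ext_cons rfl fun Z x => ?_⟩
      · intro Z z
        cases z with
        | zero => exact h
        | succ z => exact hc Z z
      · rw [← hρ' Z x]
        change Fam.cons p _ Z (Fam.cons .zero _ Z (ρ Z x)) = Fam.cons p c Z (ρ Z x)
        cases ρ Z x <;> rfl

/-- A renaming that does not reach the first variable, since the value there is fresh. -/
theorem exists_ren_succ {C : L.Sorts → Type*} (D : ∀ X, C X → Prop) {X : L.Sorts} {p : C X}
    (hp : ¬ D X p) {V U : Ctx L} (c : Fam C U) (ρ : Ren V (X :: U))
    (h : ∀ Y y, D Y (ρ.pull (Fam.cons p c) Y y)) : ∃ ρ' : Ren V U, ρ = fun Y y => (ρ' Y y).succ := by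
  have (Y) (y : Var V Y) : ∃ z, ρ Y y = .succ z := by
    have := h Y y
    simp only [Ren.pull] at this
    cases hz : ρ Y y with
    | zero =>
      rw [hz] at this
      exact (hp this).elim
    | succ z => exact ⟨z, rfl⟩
  choose ρ' hρ' using this
  exact ⟨ρ', funext fun Y => funext fun y => hρ' Y y⟩

/-- As nothing is declared about a parameter that does not exist, what a state declares true at
`Fam.cons p c` is a weakening of what it declares true at `c`. -/
theorem Admissible.posAt_cons {A : Set (Item.{u, w} V₀)} (hA : Admissible T A) {U : Ctx L}
    {X : L.Sorts} {p : Param.{u, w} V₀ X} (hp : .dom p ∉ A) {c : Fam (Param.{u, w} V₀) U}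
    {γ : Formula L (X :: U)} (h : PosAt A (Fam.cons p c) γ) :
    γ ∈ Formula.subst (Subst.wk U X) '' {γ | PosAt A c γ} := by
  obtain ⟨V, φ, ρ, h, rfl⟩ := h
  obtain ⟨ρ, rfl⟩ := exists_ren_succ (fun X (p : Param.{u, w} V₀ X) => .dom p ∈ A) hp c ρ
    (hA.dom_of_pos φ _ h)
  exact ⟨φ.subst ρ.toSubst, ⟨V, φ, ρ, h, rfl⟩, Formula.subst_subst ρ.toSubst (Subst.wk U X) φ⟩

theorem Admissible.negAt_cons {A : Set (Item.{u, w} V₀)} (hA : Admissible T A) {U : Ctx L}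
    {X : L.Sorts} {p : Param.{u, w} V₀ X} (hp : .dom p ∉ A) {c : Fam (Param.{u, w} V₀) U}
    {γ : Formula L (X :: U)} (h : NegAt A (Fam.cons p c) γ) :
    γ ∈ Formula.subst (Subst.wk U X) '' {γ | NegAt A c γ} := by
  obtain ⟨V, φ, ρ, h, rfl⟩ := h
  obtain ⟨ρ, rfl⟩ := exists_ren_succ (fun X (p : Param.{u, w} V₀ X) => .dom p ∈ A) hp c ρ
    (hA.dom_of_neg φ _ h)
  exact ⟨φ.subst ρ.toSubst, ⟨V, φ, ρ, h, rfl⟩, Formula.subst_subst ρ.toSubst (Subst.wk U X) φ⟩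

/-- The left rule for `∃`: a fresh witness of a true existential formula can be added. -/
theorem Admissible.consistent_insert_wit {A : Set (Item.{u, w} V₀)} (hA : Admissible T A)
    {V : Ctx L} {X : L.Sorts} {φ : Formula L (X :: V)} {a : Fam (Param.{u, w} V₀) V}
    (h : .pos (.ex X φ) a ∈ A) {p : Param.{u, w} V₀ X} (hp : .dom p ∉ A) :
    Consistent T (insert (.dom p) (insert (.pos φ (Fam.cons p a)) A)) := by
  intro W b Γ Δ hd hr
  obtain ⟨U₁, c₁, ρ, hc₁, rfl⟩ := exists_split (fun X (p : Param.{u, w} V₀ X) => .dom p ∈ A) p b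
    fun Y y => by
      rcases hr.dom Y y with h | h | h
      · simp only [Item.dom.injEq] at h
        exact Or.inl (Sigma.ext h.1 h.2)
      · cases h
      · exact Or.inr h
  obtain ⟨U, c, τ, σ, hinj, hc, rfl, rfl⟩ := exists_injective_merge₂
    (fun X (p : Param.{u, w} V₀ X) => .dom p ∈ A) a (hA.dom_of_pos _ a h) c₁ hc₁
  have hσ : Fam.cons p (σ.pull c) = (σ.lift X).pull (Fam.cons p c) :=
    Fam.ext_cons rfl fun _ _ => rfl
  rw [hσ] at hr
  replace hr := hr.rename (c := Fam.cons p c) (fun Y y => σ.lift X Y (ρ Y y)) fun Y y => by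
    cases y with
    | zero => exact Or.inl rfl
    | succ y => exact Or.inr (Or.inr (hc Y y))
  replace hd := hd.subst (Ren.toSubst fun Y y => σ.lift X Y (ρ Y y))
  generalize Γ.image (Formula.subst (Ren.toSubst fun Y y => σ.lift X Y (ρ Y y))) = Γ at hr hd
  generalize Δ.image (Formula.subst (Ren.toSubst fun Y y => σ.lift X Y (ρ Y y))) = Δ at hr hd
  have hinj' : (Fam.cons p c).Injective := hinj.cons fun x hx => hp (hx ▸ hc X x)
  -- Up to weakening from `U` to `X :: U`, the sequent `Γ ⊢ Δ` has only `φ` in addition to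
  -- declarations of `A`.
  obtain ⟨Γ', hΓ', hΓ⟩ := Finset.subset_set_image_iff.1
    (show (↑(Γ.erase (φ.subst (τ.toSubst.lift X))) : Set _) ⊆
      Formula.subst (Subst.wk U X) '' {γ | PosAt A c γ} from fun γ hγ => by
    obtain ⟨hne, hγ⟩ := Finset.mem_erase.1 hγ
    obtain h | ⟨ρ, hρ, rfl⟩ := ((hr.pos γ hγ).of_insert nofun).of_insert_pos
    · exact hA.posAt_cons hp h
    · have hτ : Fam.cons p (τ.pull c) = (τ.lift X).pull (Fam.cons p c) :=
        Fam.ext_cons rfl fun _ _ => rfl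
      rw [hinj'.ren_eq (hρ.trans hτ), Ren.toSubst_lift] at hne
      exact (hne rfl).elim)
  obtain ⟨Δ', hΔ', hΔ⟩ := Finset.subset_set_image_iff.1
    (show (↑Δ : Set _) ⊆ Formula.subst (Subst.wk U X) '' {γ | NegAt A c γ} from fun δ hδ =>
      hA.negAt_cons hp (((hr.neg δ hδ).of_insert nofun).of_insert nofun))
  have hd' : Derivable T (insert (.ex X (φ.subst (τ.toSubst.lift X))) Γ') Δ' := by
    refine .exL (hd.weaken ?_ hΔ.ge)
    rw [hΓ]
    exact Finset.insert_erase_subset _ _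
  refine hA.consistent U c _ _ hd' ⟨hc, ?_, fun δ hδ => hΔ' hδ⟩
  refine Finset.forall_mem_insert _ _ _ |>.2 ⟨⟨V, .ex X φ, τ, h, rfl⟩, fun γ hγ => hΓ' hγ⟩

/-- In a maximal state every true existential formula has its named witness. -/
theorem dom_wit_of_maximal {A : Set (Item.{u, w} V₀)} (hA : Maximal (Admissible T) A) {V : Ctx L}
    {X : L.Sorts} {φ : Formula L (X :: V)} {a : Fam (Param.{u, w} V₀) V}
    (h : .pos (.ex X φ) a ∈ A) : .dom (.wit φ a) ∈ A := by
  by_contra hp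
  refine hp (hA.le_of_ge
    (y := insert (.dom (.wit φ a)) (insert (.pos φ (Fam.cons (.wit φ a) a)) A))
    ⟨hA.prop.consistent_insert_wit h hp, ?_, ?_, ?_⟩
    ((Set.subset_insert _ _).trans (Set.subset_insert _ _)) (Set.mem_insert _ _))
  · rintro V' φ' a' (h' | h' | h') Y y
    · cases h'
    · simp only [Item.pos.injEq] at h'
      obtain ⟨rfl, -, h'⟩ := h'
      obtain rfl := eq_of_heq h'
      cases y with
      | zero => exact Or.inl rfl
      | succ y => exact Or.inr (Or.inr (hA.prop.dom_of_pos _ _ h Y y))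
    · exact Or.inr (Or.inr (hA.prop.dom_of_pos φ' a' h' Y y))
  · rintro V' φ' a' (h' | h' | h') Y y
    · cases h'
    · cases h'
    · exact Or.inr (Or.inr (hA.prop.dom_of_neg φ' a' h' Y y))
  · rintro V' Y φ' a' (h' | h' | h')
    · cases h'
      exact Or.inr (Or.inl rfl)
    · cases h'
    · exact Or.inr (Or.inr (hA.prop.pos_of_wit φ' a' h'))

theorem Consistent.not_posAt_negAt {A : Set (Item.{u, w} V₀)} (hA : Consistent T A) {W : Ctx L}
    {b : Fam (Param.{u, w} V₀) W} (hb : ∀ X x, .dom (b X x) ∈ A) {γ : Formula L W}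
    (hp : PosAt A b γ) (hn : NegAt A b γ) : False :=
  hA W b {γ} {γ} (.id γ) ⟨hb, by simpa using hp, by simpa using hn⟩

/-- A maximal admissible state is a saturated prime diagram on its existing parameters. -/
def diagramOfMaximal {A : Set (Item.{u, w} V₀)} (hA : Maximal (Admissible T) A) :
    Diagram.{u, max u w} T where
  P X := {p : Param.{u, w} V₀ X // .dom p ∈ A}
  Tr φ a := .pos φ (Fam.map (fun _ => Subtype.val) a) ∈ A
  closed {V Γ Δ} hd a h := by
    by_contra! h'
    refine hA.prop.consistent V _ Γ Δ hd ⟨fun X x => (a X x).2, fun γ hγ => .of_mem (h γ hγ),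
      fun δ hδ => .of_mem ((pos_or_neg_of_maximal hA δ _ fun X x => (a X x).2).resolve_left
        (h' δ hδ))⟩
  ren ρ φ b := by
    have hb (X) (x) := (b X x).2
    constructor
    · intro h
      refine (pos_or_neg_of_maximal hA φ _ fun X x => hb X (ρ X x)).resolve_right fun hn => ?_
      exact hA.prop.consistent.not_posAt_negAt hb (.of_mem h) ⟨_, φ, ρ, hn, rfl⟩
    · intro h
      refine (pos_or_neg_of_maximal hA _ _ hb).resolve_right fun hn => ?_
      exact hA.prop.consistent.not_posAt_negAt hb ⟨_, φ, ρ, h, rfl⟩ (.of_mem hn)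
  wit φ a h := by
    refine ⟨⟨_, dom_wit_of_maximal hA h⟩, ?_⟩
    rw [Fam.map_cons]
    exact hA.prop.pos_of_wit φ _ (dom_wit_of_maximal hA h)

/-- An underivable sequent fails in a model of the theory. -/
theorem exists_model_not_satisfies (α : Sequent L) (h : ¬ Derivable T α.ant α.suc) :
    ∃ M : Interpretation.{u, max u w} L, M.IsModel T ∧ ¬ M.Satisfies α := by
  obtain ⟨A, hsub, hA⟩ := (admissible_initial.{u, w} h).exists_maximal
  let D := diagramOfMaximal hA
  refine ⟨D.model, D.model_isModel, fun hs => ?_⟩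
  have hdom (X) (x : Var α.ctx X) : .dom (.base x) ∈ A := hsub (.dom x)
  obtain ⟨δ, hδ, hpos⟩ := (D.model_satisfies_iff α).1 hs (fun X x => ⟨.base x, hdom X x⟩)
    fun γ hγ => hsub (.pos hγ)
  exact hA.prop.consistent.not_posAt_negAt hdom (.of_mem hpos) (.of_mem (hsub (.neg hδ)))

end

end GeometricLogic

theorem mainTheorem4 (L : GeometricLogic.Language.{u}) (T : GeometricLogic.Theory L)
    (α : GeometricLogic.Sequent L) :
    GeometricLogic.Provable T α ↔
      ∀ M : GeometricLogic.Interpretation.{u, max u w} L, M.IsModel T → M.Satisfies α := by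
  refine ⟨fun h M hM => (M.satisfies_iff α).2 fun v => h.sound hM v, fun h => ?_⟩
  by_contra hα
  obtain ⟨M, hM, hn⟩ := GeometricLogic.exists_model_not_satisfies.{u, w} α hα
  exact hn (h M hM)
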